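/- Let $\lambda\in C^1(\mathbb R;(0,+\infty))$. For $k\in\mathbb R$ and $\rho_0\in L^2(0,1)$ consider the closed-loop Cauchy problem $$\rho_t(t,x)+(\rho(t,x)\lambda(W(t)))_x=0,\quad t>0,\ x\in(0,1),\qquad \rho(0,x)=\rho_0(x),\qquad u(t)=k\,y(t),$$ where $W(t)=\int_0^1\rho(t,x)\,dx$, $u(t)=\rho(t,0)\lambda(W(t))$ and $y(t)=\rho(t,1)\lambda(W(t))$. A (weak) solution is a function $\rho\in C^0([0,+\infty);L^2(0,1))$ such that, for every $\tau\ge 0$ and every $\varphi\in C^1([0,\tau]\times[0,1])$ with $\varphi(\tau,\cdot)=0$ on $[0,1]$ and $\varphi(\cdot,1)=0$ on $[0,\tau]$, $$-\int_0^\tau\!\!\int_0^1\rho\,\big(\varphi_t+\lambda(W(t))\varphi_x\big)\,dx\,dt-\int_0^1\rho_0(x)\varphi(0,x)\,dx+\int_0^\tau\big(y(t)\varphi(t,1)-k\,y(t)\varphi(t,0)\big)\,dt=0.$$ Here $\rho(\cdot,1)\in L^1_{loc}([0,+\infty))$ is the trace of $\rho$ at $x=1$, i.e. $\frac1\varepsilon\int_0^T\int_{1-\varepsilon}^1|\rho(t,x)-\rho(t,1)|\,dx\,dt\to0$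 as $\varepsilon\to0^+$ for every $T>0$. Theorem. For every $k\in(-1,1)$ and every $R>0$ there exist constants $C>0$ and $\alpha>0$, depending only on $\lambda$, $k$ and $R$, such that for every $\rho_0\in L^2(0,1)$ with $\|\rho_0\|_{L^1(0,1)}\le R$, every solution $\rho\in C^0([0,+\infty);L^2(0,1))$ of this Cauchy problem satisfies $$\|\rho(t,\cdot)\|_{L^2(0,1)}\le C e^{-\alpha t}\|\rho_0\|_{L^2(0,1)}\qquad\text{for all } t\in[0,+\infty).$$ -/

import Mathlib

open MeasureTheory Set Filter Topology
open scoped ENNReal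

noncomputable section

namespace NonlocalConservation

/-- Lebesgue measure on the interval `(0,1)`. -/
abbrev unitMeasure : Measure ℝ := volume.restrict (Ioo (0 : ℝ) 1)

/-- The space `L^p(0,1)` of real-valued functions. -/
abbrev LpUnit (p : ℝ≥0∞) : Type := Lp ℝ p unitMeasure

/-- The total mass `W(t) = ∫₀¹ ρ(t,x) dx`. -/
def mass {p : ℝ≥0∞} (ρ : ℝ → LpUnit p) (t : ℝ) : ℝ :=
  ∫ x, ρ t x ∂unitMeasure

/-- `r(t)` is the boundary value `ρ(t,1)`, for almost every `t > 0`, in the sense of strong `L¹`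
traces: `r` is in `L¹(0,T)` for every `T`, and the mean over `x ∈ (1-ε,1)` of
`∫₀ᵀ |ρ(t,x) - r(t)| dt` tends to `0` as `ε → 0⁺`. Such an `r` is unique almost everywhere. -/
def IsTraceAtOne {p : ℝ≥0∞} (ρ : ℝ → LpUnit p) (r : ℝ → ℝ) : Prop :=
  ∀ T : ℝ, 0 < T →
    IntegrableOn r (Ioo 0 T) ∧
    Tendsto (fun ε : ℝ => ε⁻¹ * ∫ t in Ioo 0 T, ∫ x in Ioo (1 - ε) 1, |ρ t x - r t|)
      (𝓝[>] 0) (𝓝 0)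

/-- The outflux `y(t) = ρ(t,1) λ(W(t))`, where `r t` stands for `ρ(t,1)`. -/
def outflux {p : ℝ≥0∞} (lam : ℝ → ℝ) (ρ : ℝ → LpUnit p) (r : ℝ → ℝ) (t : ℝ) : ℝ :=
  r t * lam (mass ρ t)

/-- Test functions on `[0,τ] × [0,1]`: (restrictions of) `C¹` functions that vanish at `t = τ`
and at `x = 1`. -/
structure IsTestFunction (τ : ℝ) (φ : ℝ → ℝ → ℝ) : Prop where
  contDiff : ContDiff ℝ 1 (Function.uncurry φ)
  final_eq_zero : ∀ x ∈ Icc (0 : ℝ) 1, φ τ x = 0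
  right_eq_zero : ∀ t ∈ Icc (0 : ℝ) τ, φ t 1 = 0

/-- The weak formulation on `[0,τ]`, tested against `φ`, of `ρ_t + (ρ λ(W))_x = 0` with initial
datum `ρ₀`, outflux `y` at `x = 1` and influx
`u = ρbar λ(ρbar) + k (y - ρbar λ(ρbar)) = k y + (1 - k) ρbar λ(ρbar)` at `x = 0`. -/
def WeakIdentity {p : ℝ≥0∞} (lam : ℝ → ℝ) (ρbar k : ℝ) (ρ₀ : ℝ → ℝ) (ρ : ℝ → LpUnit p)
    (y : ℝ → ℝ) (τ : ℝ) (φ : ℝ → ℝ → ℝ) : Prop :=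
  -(∫ t in (0 : ℝ)..τ, ∫ x, ρ t x *
        (deriv (fun s => φ s x) t + lam (mass ρ t) * deriv (fun z => φ t z) x) ∂unitMeasure)
    - (∫ x, ρ₀ x * φ 0 x ∂unitMeasure)
    + (∫ t in (0 : ℝ)..τ,
        (y t * φ t 1 - (k * y t + (1 - k) * ρbar * lam ρbar) * φ t 0)) = 0

/-- `ρ ∈ C⁰([0,∞); L^p(0,1))` is a weak solution of the closed loop Cauchy problem
`ρ_t + (ρ λ(W))_x = 0`, `ρ(0,·) = ρ₀`, `u - ρbar λ(ρbar) = k (y - ρbar λ(ρbar))`, where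
`u(t) = ρ(t,0) λ(W(t))` and `y(t) = ρ(t,1) λ(W(t))`. Only times `t ≥ 0` matter. -/
def IsWeakSolution {p : ℝ≥0∞} [Fact (1 ≤ p)] (lam : ℝ → ℝ) (ρbar k : ℝ) (ρ₀ : ℝ → ℝ)
    (ρ : ℝ → LpUnit p) : Prop :=
  ContinuousOn ρ (Ici 0) ∧
  ∃ r : ℝ → ℝ, IsTraceAtOne ρ r ∧
    ∀ τ : ℝ, 0 ≤ τ → ∀ φ : ℝ → ℝ → ℝ, IsTestFunction τ φ →
      WeakIdentity lam ρbar k ρ₀ ρ (outflux lam ρ r) τ φ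

end NonlocalConservation

end

noncomputable section

namespace NonlocalConservation

/-! The proof is by duality along characteristics. Write θ(t) for the integral of λ(W) over (0,t),
which is `travel`. Since λ(W) depends on time only, ψ(x - θ(t)) solves the adjoint transport
equation for every C¹ function ψ. If also kψ(-θ) = ψ(1 - θ), the boundary contributions cancel and
the pairing of ρ(t) with ψ(· - θ(t)) is conserved (`pairing_eq_initial`). Test functions must vanish
at x = 1, so ψ is first multiplied by a cutoff; the strong trace identifies the limit of the cutoff
term (`tendsto_integral_deriv_cutoff`).

Given a final value f supported in (0,1) and Θ = θ(τ), the adjoint solution is explicit: ψ(z) = ∑ kⁿ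
f(z + Θ - n). The translates of f have disjoint supports, and on (0,1) only those with n > Θ - 1 are
seen. Hence sup |ψ| ≤ sup |f|, while the L² norm of ψ on (0,1) is at most exp(-b(Θ - 1)) times that
of f when |k| ≤ exp(-b).

The sup bound, with f increasing to 1, keeps |W| below the L¹ norm of ρ₀ (`abs_mass_le`), so λ(W) is
at least the minimum of λ on [-R,R] and θ grows at least linearly. The L² bound gives decay in θ
(`norm_le_exp_travel`), hence in time. -/

instance : IsProbabilityMeasure unitMeasure := ⟨by simp⟩

/-! ### Integrals and pairings on (0,1) -/

lemma integrable_lpUnit (u : LpUnit 2) : Integrable u unitMeasure :=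
  (Lp.memLp u).integrable (by norm_num)

lemma integral_abs_le_norm (u : LpUnit 2) : ∫ x, |u x| ∂unitMeasure ≤ ‖u‖ := by
  have h1 : eLpNorm u 1 unitMeasure ≤ eLpNorm u 2 unitMeasure :=
    eLpNorm_le_eLpNorm_of_exponent_le (by norm_num) (Lp.aestronglyMeasurable u)
  have h2 : ∫ x, |u x| ∂unitMeasure = (eLpNorm u 1 unitMeasure).toReal := by
    rw [eLpNorm_one_eq_lintegral_enorm, ← integral_norm_eq_lintegral_enorm
      (Lp.aestronglyMeasurable u)]
    rfl
  rw [h2, Lp.norm_def]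
  exact ENNReal.toReal_mono (Lp.eLpNorm_ne_top u) h1

lemma integral_unitMeasure (f : ℝ → ℝ) : ∫ x, f x ∂unitMeasure = ∫ x in (0 : ℝ)..1, f x := by
  rw [intervalIntegral.integral_of_le zero_le_one, integral_Ioc_eq_integral_Ioo]

lemma ae_mem_unit : ∀ᵐ x ∂unitMeasure, x ∈ Ioo (0 : ℝ) 1 :=
  ae_restrict_mem measurableSet_Ioo

/-- Integrability against a function that is bounded on `(0,1)`. -/
lemma integrable_mul_of_bound {u : ℝ → ℝ} (hu : Integrable u unitMeasure) {g : ℝ → ℝ}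
    (hg : AEStronglyMeasurable g unitMeasure) {G : ℝ} (hG : ∀ x ∈ Ioo (0 : ℝ) 1, |g x| ≤ G) :
    Integrable (fun x => u x * g x) unitMeasure := by
  have hb : ∀ᵐ x ∂unitMeasure, ‖g x‖ ≤ G := by
    filter_upwards [ae_mem_unit] with x hx using hG x hx
  exact hu.mul_bdd hg hb

lemma abs_integral_mul_le {u : ℝ → ℝ} (hu : Integrable u unitMeasure) {g : ℝ → ℝ} {G : ℝ}
    (hG : ∀ x ∈ Ioo (0 : ℝ) 1, |g x| ≤ G) :
    |∫ x, u x * g x ∂unitMeasure| ≤ G * ∫ x, |u x| ∂unitMeasure := by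
  rw [← integral_const_mul, ← Real.norm_eq_abs]
  refine norm_integral_le_of_norm_le (hu.abs.const_mul G) ?_
  filter_upwards [ae_mem_unit] with x hx
  rw [Real.norm_eq_abs, abs_mul, mul_comm]
  exact mul_le_mul_of_nonneg_right (hG x hx) (abs_nonneg _)

lemma integrable_mul_continuous {u : ℝ → ℝ} (hu : Integrable u unitMeasure) {g : ℝ → ℝ}
    (hg : Continuous g) : Integrable (fun x => u x * g x) unitMeasure := by
  obtain ⟨G, hG⟩ := (isCompact_Icc (a := (0 : ℝ)) (b := 1)).exists_bound_of_continuousOn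
    hg.continuousOn
  exact integrable_mul_of_bound hu hg.aestronglyMeasurable fun x hx => hG x (Ioo_subset_Icc_self hx)

/-- The pairing of a continuous curve in `L²(0,1)` with a continuous function is continuous. -/
lemma continuous_pairing {ρ : ℝ → LpUnit 2} (hρ : Continuous ρ) {g : ℝ → ℝ → ℝ}
    (hg : Continuous (Function.uncurry g)) :
    Continuous fun t => ∫ x, ρ t x * g t x ∂unitMeasure := by
  rw [continuous_iff_continuousAt]
  intro t₀
  obtain ⟨G, hG⟩ := ((isCompact_Icc (a := t₀ - 1) (b := t₀ + 1)).prod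
    (isCompact_Icc (a := (0 : ℝ)) (b := 1))).exists_bound_of_continuousOn hg.continuousOn
  have hcont : ∀ t, Continuous (g t) := fun t => hg.comp (by fun_prop : Continuous fun x => (t, x))
  have hnear : ∀ᶠ t in 𝓝 t₀, t ∈ Icc (t₀ - 1) (t₀ + 1) :=
    Icc_mem_nhds (by linarith) (by linarith)
  have hbd : ∀ t ∈ Icc (t₀ - 1) (t₀ + 1), ∀ x ∈ Ioo (0 : ℝ) 1, |g t x| ≤ G :=
    fun t ht x hx => hG (t, x) ⟨ht, Ioo_subset_Icc_self hx⟩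
  have h1 : ContinuousAt (fun t => ∫ x, ρ t₀ x * g t x ∂unitMeasure) t₀ := by
    refine continuousAt_of_dominated (bound := fun x => |ρ t₀ x| * G) ?_ ?_ ?_ ?_
    · exact Eventually.of_forall fun t =>
        (integrable_mul_continuous (integrable_lpUnit _) (hcont t)).aestronglyMeasurable
    · filter_upwards [hnear] with t ht
      filter_upwards [ae_mem_unit] with x hx
      rw [norm_mul]
      exact mul_le_mul_of_nonneg_left (hbd t ht x hx) (abs_nonneg _)
    · exact (integrable_lpUnit _).abs.mul_const _
    · refine Eventually.of_forall fun x => ?_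
      exact (continuous_const.mul (hg.comp (by fun_prop : Continuous fun t => (t, x)))).continuousAt
  -- Split ρ(t) as ρ(t₀) plus an increment: dominated convergence handles the first part, the norm
  -- of the increment the second.
  have h2 : Tendsto (fun t => ∫ x, (ρ t - ρ t₀ : LpUnit 2) x * g t x ∂unitMeasure) (𝓝 t₀) (𝓝 0) := by
    have h3 : Tendsto (fun t => G * ‖ρ t - ρ t₀‖) (𝓝 t₀) (𝓝 0) := by
      have : Continuous fun t => G * ‖ρ t - ρ t₀‖ := by fun_prop
      simpa using this.tendsto t₀
    refine squeeze_zero_norm' ?_ h3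
    filter_upwards [hnear] with t ht
    have hG0 : 0 ≤ G := (abs_nonneg _).trans (hbd t ht (1/2) (by norm_num))
    exact (abs_integral_mul_le (integrable_lpUnit _) (hbd t ht)).trans
      (mul_le_mul_of_nonneg_left (integral_abs_le_norm _) hG0)
  have h4 := h1.tendsto.add h2
  rw [add_zero] at h4
  refine h4.congr fun t => ?_
  rw [← integral_add (integrable_mul_continuous (integrable_lpUnit _) (hcont t))
    (integrable_mul_continuous (integrable_lpUnit _) (hcont t))]
  refine integral_congr_ae ?_
  filter_upwards [Lp.coeFn_sub (ρ t) (ρ t₀)] with x hx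
  rw [hx, Pi.sub_apply]
  ring

/-- `(u, c) ↦ ∫_{1-ε}^1 |u - c|` is continuous on `L²(0,1) × ℝ`. -/
lemma continuous_deviation {s : Set ℝ} (hs : s ⊆ Ioo 0 1) :
    Continuous fun p : LpUnit 2 × ℝ => ∫ x in s, |p.1 x - p.2| := by
  have hle : volume.restrict s ≤ unitMeasure := Measure.restrict_mono hs le_rfl
  have hint : ∀ (u : LpUnit 2) (c : ℝ), Integrable (fun x => |u x - c|) (volume.restrict s) :=
    fun u c => (((integrable_lpUnit u).sub (integrable_const c)).abs).mono_measure hle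
  have key : ∀ p q : LpUnit 2 × ℝ, (∫ x in s, |p.1 x - p.2|) - (∫ x in s, |q.1 x - q.2|)
      ≤ ‖p.1 - q.1‖ + |p.2 - q.2| := by
    intro p q
    rw [← integral_sub (hint _ _) (hint _ _)]
    have hI : Integrable (fun x => |(p.1 - q.1 : LpUnit 2) x| + |p.2 - q.2|) unitMeasure :=
      (integrable_lpUnit _).abs.add (integrable_const _)
    calc ∫ x in s, (|p.1 x - p.2| - |q.1 x - q.2|)
        ≤ ∫ x in s, (|(p.1 - q.1 : LpUnit 2) x| + |p.2 - q.2|) := by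
          refine integral_mono_ae ((hint _ _).sub (hint _ _)) (hI.mono_measure hle) ?_
          filter_upwards [ae_mono hle (Lp.coeFn_sub p.1 q.1)] with x hx
          rw [hx, Pi.sub_apply]
          have h1 := abs_sub_abs_le_abs_sub (p.1 x - p.2) (q.1 x - q.2)
          have h2 := abs_sub (p.1 x - q.1 x) (p.2 - q.2)
          have h3 : p.1 x - p.2 - (q.1 x - q.2) = p.1 x - q.1 x - (p.2 - q.2) := by ring
          rw [h3] at h1
          exact h1.trans h2
      _ ≤ ∫ x, (|(p.1 - q.1 : LpUnit 2) x| + |p.2 - q.2|) ∂unitMeasure :=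
          integral_mono_measure hle (Eventually.of_forall fun x => by positivity) hI
      _ ≤ _ := by
          rw [integral_add (integrable_lpUnit _).abs (integrable_const _)]
          have := integral_abs_le_norm (p.1 - q.1)
          simpa using this
  rw [continuous_iff_continuousAt]
  intro q
  have h0 : Tendsto (fun p : LpUnit 2 × ℝ => ‖p.1 - q.1‖ + |p.2 - q.2|) (𝓝 q) (𝓝 0) := by
    have : Continuous fun p : LpUnit 2 × ℝ => ‖p.1 - q.1‖ + |p.2 - q.2| := by fun_prop
    simpa using this.tendsto q
  refine tendsto_iff_norm_sub_tendsto_zero.2 (squeeze_zero (fun _ => norm_nonneg _) (fun p => ?_) h0)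
  rw [Real.norm_eq_abs, abs_le]
  have h1 := key p q
  have h2 := key q p
  rw [norm_sub_rev, abs_sub_comm] at h2
  constructor <;> linarith

/-! ### Cutoff at x = 1 and the strong trace -/

/-- A smooth function of `x`, equal to `1` for `x ≤ 1 - ε` and to `0` for `x ≥ 1`. -/
def cutoff (ε x : ℝ) : ℝ := Real.smoothTransition ((1 - x) / ε)

lemma contDiff_cutoff (ε : ℝ) : ContDiff ℝ 1 (cutoff ε) :=
  Real.smoothTransition.contDiff.comp (by fun_prop)

lemma cutoff_nonneg (ε x : ℝ) : 0 ≤ cutoff ε x := Real.smoothTransition.nonneg _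

lemma cutoff_le_one (ε x : ℝ) : cutoff ε x ≤ 1 := Real.smoothTransition.le_one _

lemma abs_cutoff_le (ε x : ℝ) : |cutoff ε x| ≤ 1 := by
  rw [abs_of_nonneg (cutoff_nonneg ε x)]; exact cutoff_le_one ε x

lemma cutoff_one (ε : ℝ) : cutoff ε 1 = 0 := by simp [cutoff]

lemma cutoff_eq_one {ε x : ℝ} (hε : 0 < ε) (hx : x ≤ 1 - ε) : cutoff ε x = 1 :=
  Real.smoothTransition.one_of_one_le (by rw [le_div_iff₀ hε]; linarith)

lemma eventually_cutoff_eq_one {x : ℝ} (hx : x < 1) : ∀ᶠ ε in 𝓝[>] (0 : ℝ), cutoff ε x = 1 := by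
  filter_upwards [Ioo_mem_nhdsGT (by linarith : (0 : ℝ) < 1 - x)] with ε hε
  exact cutoff_eq_one hε.1 (by linarith [hε.2])

/-- By scaling, the derivative is of size 1/ε on a layer of width ε, with M independent of ε. This
matches the mean over (1 - ε, 1) in the definition of the trace. -/
lemma exists_deriv_cutoff_bound : ∃ M : ℝ, 0 ≤ M ∧ ∀ ε : ℝ, 0 < ε → ∀ x ∈ Ioo (0 : ℝ) 1,
    |deriv (cutoff ε) x| ≤ (Ioo (1 - ε) 1).indicator (fun _ => M * ε⁻¹) x := by
  have hcd : ContDiff ℝ 1 Real.smoothTransition := Real.smoothTransition.contDiff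
  obtain ⟨M, hM⟩ := (isCompact_Icc (a := (0 : ℝ)) (b := 1)).exists_bound_of_continuousOn
    (hcd.continuous_deriv le_rfl).continuousOn
  have hM0 : 0 ≤ M := (norm_nonneg _).trans (hM 0 (by norm_num))
  refine ⟨M, hM0, fun ε hε x hx => ?_⟩
  have hd : HasDerivAt (cutoff ε) (deriv Real.smoothTransition ((1 - x) / ε) * (-1 / ε)) x := by
    have h1 : HasDerivAt (fun x : ℝ => (1 - x) / ε) (-1 / ε) x := by
      simpa using ((hasDerivAt_id x).const_sub 1).div_const ε
    exact ((hcd.differentiable one_ne_zero) _).hasDerivAt.comp x h1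
  rw [hd.deriv]
  by_cases hx' : 1 - ε < x
  · rw [indicator_of_mem (show x ∈ Ioo (1 - ε) 1 from ⟨hx', hx.2⟩), abs_mul, abs_div,
      abs_neg, abs_one, abs_of_pos hε, one_div]
    refine mul_le_mul_of_nonneg_right (hM _ ⟨?_, ?_⟩) (by positivity)
    · exact div_nonneg (by linarith [hx.2]) hε.le
    · rw [div_le_one hε]; linarith
  · rw [indicator_of_notMem fun h => hx' h.1]
    have h1 : (1 : ℝ) ≤ (1 - x) / ε := by rw [le_div_iff₀ hε]; linarith
    -- The transition takes its maximal value 1 here, so its derivative vanishes, also at the edge x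
    -- = 1 - ε.
    have hmax : IsLocalMax Real.smoothTransition ((1 - x) / ε) :=
      Eventually.of_forall fun z => by
        rw [Real.smoothTransition.one_of_one_le h1]; exact Real.smoothTransition.le_one z
    rw [hmax.deriv_eq_zero]
    simp

lemma integral_deriv_cutoff {ε : ℝ} (hε : 0 < ε) (hε1 : ε ≤ 1) :
    ∫ x, deriv (cutoff ε) x ∂unitMeasure = -1 := by
  have hc := contDiff_cutoff ε
  rw [integral_unitMeasure, intervalIntegral.integral_deriv_eq_sub
    (fun x _ => (hc.differentiable one_ne_zero) x)
    ((hc.continuous_deriv le_rfl).intervalIntegrable _ _), cutoff_one,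
    cutoff_eq_one hε (by linarith)]
  norm_num

/-- The trace r is only measurable in time; measurability of the deviation follows by composing t ↦
(ρ(t), r(t)) with the continuous map of `continuous_deviation`. -/
lemma integrableOn_deviation {ρ : ℝ → LpUnit 2} (hρ : Continuous ρ) {r : ℝ → ℝ} {T : ℝ}
    (hr : IntegrableOn r (Ioo 0 T)) {s : Set ℝ} (hs : s ⊆ Ioo 0 1) :
    IntegrableOn (fun t => ∫ x in s, |ρ t x - r t|) (Ioo 0 T) := by
  have hle : volume.restrict s ≤ unitMeasure := Measure.restrict_mono hs le_rfl
  have hmeas : AEStronglyMeasurable (fun t => ∫ x in s, |ρ t x - r t|)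
      (volume.restrict (Ioo 0 T)) :=
    (continuous_deviation hs).comp_aestronglyMeasurable
      (hρ.aestronglyMeasurable.prodMk hr.aestronglyMeasurable)
  have hρi : IntegrableOn (fun t => ‖ρ t‖) (Ioo 0 T) :=
    (hρ.norm.integrableOn_Icc).mono_set Ioo_subset_Icc_self
  refine (hρi.add hr.abs).mono' hmeas (Eventually.of_forall fun t => ?_)
  rw [Real.norm_of_nonneg (by positivity)]
  have hI : Integrable (fun x => |ρ t x| + |r t|) unitMeasure :=
    (integrable_lpUnit _).abs.add (integrable_const _)
  calc ∫ x in s, |ρ t x - r t| ≤ ∫ x in s, (|ρ t x| + |r t|) := by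
        refine integral_mono
          ((((integrable_lpUnit _).sub (integrable_const _)).abs).mono_measure hle)
          (hI.mono_measure hle) fun x => abs_sub _ _
    _ ≤ ∫ x, (|ρ t x| + |r t|) ∂unitMeasure :=
        integral_mono_measure hle (Eventually.of_forall fun x => by positivity) hI
    _ ≤ _ := by
        rw [integral_add (integrable_lpUnit _).abs (integrable_const _)]
        have := integral_abs_le_norm (ρ t)
        simpa using this

/-- Testing against the derivative of the cutoff recovers the trace at `x = 1`. -/
lemma tendsto_integral_deriv_cutoff {ρ : ℝ → LpUnit 2} (hρ : Continuous ρ) {r : ℝ → ℝ}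
    (hr : IsTraceAtOne ρ r) {τ : ℝ} (hτ : 0 < τ) {a : ℝ → ℝ → ℝ}
    (ha : Continuous (Function.uncurry a)) {A K : ℝ}
    (hA : ∀ t ∈ Ioo 0 τ, ∀ x ∈ Icc (0 : ℝ) 1, |a t x| ≤ A)
    (hK : ∀ t ∈ Ioo 0 τ, ∀ x ∈ Icc (0 : ℝ) 1, |a t x - a t 1| ≤ K * (1 - x)) :
    Tendsto (fun ε => ∫ t in (0 : ℝ)..τ, ∫ x, ρ t x * (a t x * deriv (cutoff ε) x) ∂unitMeasure)
      (𝓝[>] 0) (𝓝 (-∫ t in (0 : ℝ)..τ, r t * a t 1)) := by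
  obtain ⟨hrI, hrlim⟩ := hr τ hτ
  obtain ⟨M, hM0, hM⟩ := exists_deriv_cutoff_bound
  have hA0 : 0 ≤ A := (abs_nonneg _).trans (hA (τ / 2) ⟨by linarith, by linarith⟩ 0 (by norm_num))
  have hK0 : 0 ≤ K := by
    have := (abs_nonneg _).trans (hK (τ / 2) ⟨by linarith, by linarith⟩ 0 (by norm_num))
    linarith
  have hat : ∀ t, Continuous (a t) := fun t => ha.comp (by fun_prop : Continuous fun x => (t, x))
  have ha1 : Continuous fun t => a t 1 := ha.comp (by fun_prop : Continuous fun t : ℝ => (t, (1 : ℝ)))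
  have hra : IntegrableOn (fun t => r t * a t 1) (Ioo 0 τ) := by
    refine Integrable.mul_bdd (c := A) hrI ha1.aestronglyMeasurable ?_
    filter_upwards [ae_restrict_mem measurableSet_Ioo] with t ht using hA t ht 1 (by norm_num)
  have hbound : Tendsto (fun ε : ℝ => M * A * (ε⁻¹ * ∫ t in Ioo 0 τ, ∫ x in Ioo (1 - ε) 1, |ρ t x - r t|)
      + M * K * ε * ∫ t in Ioo 0 τ, |r t|) (𝓝[>] 0) (𝓝 0) := by
    have h1 : Tendsto (fun ε : ℝ => M * K * ε * ∫ t in Ioo 0 τ, |r t|) (𝓝[>] 0) (𝓝 0) := by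
      have : Continuous fun ε : ℝ => M * K * ε * ∫ t in Ioo 0 τ, |r t| := by fun_prop
      simpa using (this.tendsto 0).mono_left nhdsWithin_le_nhds
    simpa using (hrlim.const_mul (M * A)).add h1
  refine tendsto_iff_norm_sub_tendsto_zero.2
    (squeeze_zero' (Eventually.of_forall fun _ => norm_nonneg _) ?_ hbound)
  filter_upwards [Ioo_mem_nhdsGT (zero_lt_one : (0 : ℝ) < 1)] with ε hε
  have hs : Ioo (1 - ε) 1 ⊆ Ioo (0 : ℝ) 1 := Ioo_subset_Ioo_left (by linarith [hε.2])
  have hle : volume.restrict (Ioo (1 - ε) 1) ≤ unitMeasure := Measure.restrict_mono hs le_rfl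
  have hd : Continuous (deriv (cutoff ε)) := (contDiff_cutoff ε).continuous_deriv le_rfl
  have hI : Continuous fun t => ∫ x, ρ t x * (a t x * deriv (cutoff ε) x) ∂unitMeasure :=
    continuous_pairing hρ (g := fun t x => a t x * deriv (cutoff ε) x)
      (ha.mul (hd.comp continuous_snd))
  rw [sub_neg_eq_add, intervalIntegral.integral_of_le hτ.le, intervalIntegral.integral_of_le hτ.le,
    integral_Ioc_eq_integral_Ioo, integral_Ioc_eq_integral_Ioo,
    ← integral_add (hI.integrableOn_Icc.mono_set Ioo_subset_Icc_self) hra]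
  have hdev := integrableOn_deviation hρ hrI hs
  have hB : Integrable (fun t => M * A * ε⁻¹ * (∫ x in Ioo (1 - ε) 1, |ρ t x - r t|)
      + M * K * ε * |r t|) (volume.restrict (Ioo 0 τ)) :=
    (hdev.const_mul _).add (hrI.abs.const_mul _)
  have hfin : M * A * (ε⁻¹ * ∫ t in Ioo 0 τ, ∫ x in Ioo (1 - ε) 1, |ρ t x - r t|)
      + M * K * ε * ∫ t in Ioo 0 τ, |r t| =
      ∫ t in Ioo 0 τ, (M * A * ε⁻¹ * (∫ x in Ioo (1 - ε) 1, |ρ t x - r t|)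
      + M * K * ε * |r t|) := by
    rw [integral_add (hdev.const_mul _) (hrI.abs.const_mul _), integral_const_mul,
      integral_const_mul]
    ring
  rw [hfin]
  refine norm_integral_le_of_norm_le hB ?_
  filter_upwards [ae_restrict_mem measurableSet_Ioo] with t ht
  have hint1 : Integrable (fun x => ρ t x * (a t x * deriv (cutoff ε) x)) unitMeasure :=
    integrable_mul_continuous (integrable_lpUnit _) ((hat t).mul hd)
  have hint2 : Integrable (fun x => r t * a t 1 * deriv (cutoff ε) x) unitMeasure :=
    integrable_mul_continuous (u := fun _ => r t * a t 1) (integrable_const _) hd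
  have heq : (∫ x, ρ t x * (a t x * deriv (cutoff ε) x) ∂unitMeasure) + r t * a t 1 =
      ∫ x, (ρ t x * a t x - r t * a t 1) * deriv (cutoff ε) x ∂unitMeasure := by
    -- The derivative of the cutoff has integral -1, so the boundary value can be brought under the
    -- integral and compared pointwise with ρ a.
    have h1 : r t * a t 1 = -∫ x, r t * a t 1 * deriv (cutoff ε) x ∂unitMeasure := by
      rw [integral_const_mul, integral_deriv_cutoff hε.1 hε.2.le]; ring
    rw [h1, ← sub_eq_add_neg, ← integral_sub hint1 (by simpa using hint2), ← h1]
    exact integral_congr_ae (Eventually.of_forall fun x => by ring)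
  rw [heq]
  have hIdev : Integrable (fun x => |ρ t x - r t|) unitMeasure :=
    ((integrable_lpUnit _).sub (integrable_const _)).abs
  have hIB : Integrable (fun x => M * A * ε⁻¹ * |ρ t x - r t| + M * K * |r t|) unitMeasure :=
    (hIdev.const_mul _).add (integrable_const _)
  have hstep : ‖∫ x, (ρ t x * a t x - r t * a t 1) * deriv (cutoff ε) x ∂unitMeasure‖ ≤
      ∫ x, (Ioo (1 - ε) 1).indicator
        (fun x => M * A * ε⁻¹ * |ρ t x - r t| + M * K * |r t|) x ∂unitMeasure := by
    refine norm_integral_le_of_norm_le (hIB.indicator measurableSet_Ioo) ?_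
    filter_upwards [ae_mem_unit] with x hx
    have hder := hM ε hε.1 x hx
    rw [norm_mul, Real.norm_eq_abs, Real.norm_eq_abs]
    by_cases hx' : x ∈ Ioo (1 - ε) 1
    · rw [indicator_of_mem hx'] at hder ⊢
      have h1 : |ρ t x * a t x - r t * a t 1| ≤ A * |ρ t x - r t| + K * ε * |r t| := by
        have e : ρ t x * a t x - r t * a t 1 = a t x * (ρ t x - r t) + (a t x - a t 1) * r t := by
          ring
        rw [e]
        refine (abs_add_le _ _).trans (add_le_add ?_ ?_)
        · rw [abs_mul]
          exact mul_le_mul_of_nonneg_right (hA t ht x (Ioo_subset_Icc_self hx)) (abs_nonneg _)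
        · rw [abs_mul]
          refine mul_le_mul_of_nonneg_right ?_ (abs_nonneg _)
          exact (hK t ht x (Ioo_subset_Icc_self hx)).trans
            (mul_le_mul_of_nonneg_left (by linarith [hx'.1]) hK0)
      calc |ρ t x * a t x - r t * a t 1| * |deriv (cutoff ε) x|
          ≤ (A * |ρ t x - r t| + K * ε * |r t|) * (M * ε⁻¹) :=
            mul_le_mul h1 hder (abs_nonneg _) ((abs_nonneg _).trans h1)
        _ = _ := by
            have := hε.1.ne'
            field_simp
    · rw [indicator_of_notMem hx'] at hder ⊢
      rw [le_antisymm hder (abs_nonneg _), mul_zero]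
  refine hstep.trans (le_of_eq ?_)
  rw [integral_indicator measurableSet_Ioo, Measure.restrict_restrict measurableSet_Ioo,
    inter_eq_self_of_subset_left hs,
    integral_add ((hIdev.const_mul _).mono_measure hle) ((integrable_const _).mono_measure hle),
    integral_const_mul]
  simp [hε.1.le]
  ring

lemma tendsto_integral_mul_cutoff {u : ℝ → ℝ} (hu : Integrable u unitMeasure) {g : ℝ → ℝ}
    (hg : Continuous g) :
    Tendsto (fun ε => ∫ x, u x * (g x * cutoff ε x) ∂unitMeasure) (𝓝[>] 0)
      (𝓝 (∫ x, u x * g x ∂unitMeasure)) := by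
  refine tendsto_integral_filter_of_dominated_convergence (fun x => |u x * g x|)
    (Eventually.of_forall fun ε => ?_) (Eventually.of_forall fun ε => Eventually.of_forall fun x => ?_)
    (integrable_mul_continuous hu hg).abs ?_
  · exact (integrable_mul_continuous hu
      (hg.mul (contDiff_cutoff ε).continuous)).aestronglyMeasurable
  · rw [Real.norm_eq_abs, ← mul_assoc, abs_mul]
    exact mul_le_of_le_one_right (abs_nonneg _) (abs_cutoff_le ε x)
  · filter_upwards [ae_mem_unit] with x hx
    refine tendsto_const_nhds.congr' ?_
    filter_upwards [eventually_cutoff_eq_one hx.2] with ε hε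
    rw [hε, mul_one]

/-! ### Characteristics and conservation of adjoint pairings -/

/-- The distance travelled up to time `t` by a characteristic of speed `lam (mass ρ t)`. -/
def travel (lam : ℝ → ℝ) (ρ : ℝ → LpUnit 2) (t : ℝ) : ℝ := ∫ s in (0 : ℝ)..t, lam (mass ρ s)

lemma continuous_mass {ρ : ℝ → LpUnit 2} (hρ : Continuous ρ) : Continuous (mass ρ) := by
  have := continuous_pairing hρ (g := fun _ _ => 1) continuous_const
  simp only [mul_one] at this
  exact this

section

variable {lam : ℝ → ℝ} {ρ : ℝ → LpUnit 2}

lemma hasDerivAt_travel (hlam : Continuous lam) (hρ : Continuous ρ) (t : ℝ) :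
    HasDerivAt (travel lam ρ) (lam (mass ρ t)) t :=
  have h := hlam.comp (continuous_mass hρ)
  intervalIntegral.integral_hasDerivAt_right (h.intervalIntegrable _ _)
    (h.stronglyMeasurableAtFilter _ _) h.continuousAt

lemma contDiff_travel (hlam : Continuous lam) (hρ : Continuous ρ) :
    ContDiff ℝ 1 (travel lam ρ) := by
  rw [contDiff_one_iff_deriv]
  refine ⟨fun t => (hasDerivAt_travel hlam hρ t).differentiableAt, ?_⟩
  rw [show deriv (travel lam ρ) = fun t => lam (mass ρ t) from
    funext fun t => (hasDerivAt_travel hlam hρ t).deriv]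
  exact hlam.comp (continuous_mass hρ)

lemma travel_zero : travel lam ρ 0 = 0 := by simp [travel]

/-- The weak formulation, tested along characteristics, with the trace at `x = 1` inserted. -/
lemma integral_deriv_mul_pairing (hlam : Continuous lam) (hρ : Continuous ρ)
    {k : ℝ} {ρ₀ : LpUnit 2} {r : ℝ → ℝ}
    (hr : IsTraceAtOne ρ r) {τ : ℝ} (hτ : 0 < τ)
    (hweak : ∀ φ : ℝ → ℝ → ℝ, IsTestFunction τ φ →
      WeakIdentity lam 0 k ρ₀ ρ (outflux lam ρ r) τ φ)
    {η : ℝ → ℝ} (hη : ContDiff ℝ 1 η) (hητ : η τ = 0)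
    {ψ : ℝ → ℝ} (hψ : ContDiff ℝ 1 ψ) {K : NNReal} (hK : LipschitzWith K ψ)
    (hk : ∀ t ∈ Icc 0 τ, k * ψ (-travel lam ρ t) = ψ (1 - travel lam ρ t)) :
    (∫ t in (0 : ℝ)..τ, deriv η t * ∫ x, ρ t x * ψ (x - travel lam ρ t) ∂unitMeasure)
      + η 0 * ∫ x, ρ₀ x * ψ x ∂unitMeasure = 0 := by
  set θ := travel lam ρ with hθdef
  have hθ : ContDiff ℝ 1 θ := contDiff_travel hlam hρ
  have hΛ : Continuous fun t => lam (mass ρ t) := hlam.comp (continuous_mass hρ)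
  have hη' : Continuous (deriv η) := hη.continuous_deriv le_rfl
  have hηc := hη.continuous
  have hψc := hψ.continuous
  have hθc := hθ.continuous
  -- The factor of the cutoff's derivative in λ(W)φ_x, for φ = η(t) ψ(x - θ(t)) times the cutoff.
  set a : ℝ → ℝ → ℝ := fun t x => lam (mass ρ t) * η t * ψ (x - θ t) with hadef
  have hψθ : Continuous (fun p : ℝ × ℝ => ψ (p.2 - θ p.1)) := by fun_prop
  have ha : Continuous (Function.uncurry a) := by
    have h1 : Continuous fun p : ℝ × ℝ => lam (mass ρ p.1) := hΛ.comp continuous_fst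
    exact (h1.mul (hηc.comp continuous_fst)).mul hψθ
  obtain ⟨A, hA⟩ := ((isCompact_Icc (a := 0) (b := τ)).prod
    (isCompact_Icc (a := (0 : ℝ)) (b := 1))).exists_bound_of_continuousOn ha.continuousOn
  obtain ⟨B, hB⟩ := (isCompact_Icc (a := 0) (b := τ)).exists_bound_of_continuousOn
    (hΛ.mul hηc).continuousOn
  obtain ⟨D, hD⟩ := ((isCompact_Icc (a := 0) (b := τ)).prod
    (isCompact_Icc (a := (0 : ℝ)) (b := 1))).exists_bound_of_continuousOn
    ((hη'.comp continuous_fst).mul hψθ).continuousOn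
  have hI2 := tendsto_integral_deriv_cutoff hρ hr hτ ha (A := A) (K := B * K)
    (fun t ht x hx => hA (t, x) ⟨Ioo_subset_Icc_self ht, hx⟩) (fun t ht x hx => by
      have h1 : a t x - a t 1 = lam (mass ρ t) * η t * (ψ (x - θ t) - ψ (1 - θ t)) := by
        simp only [hadef]; ring
      have h2 := hK.dist_le_mul (x - θ t) (1 - θ t)
      rw [Real.dist_eq, Real.dist_eq, show x - θ t - (1 - θ t) = -(1 - x) by ring, abs_neg,
        abs_of_nonneg (by linarith [hx.2] : 0 ≤ 1 - x)] at h2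
      have h3 := hB t (Ioo_subset_Icc_self ht)
      rw [h1, abs_mul, mul_assoc]
      exact mul_le_mul h3 h2 (abs_nonneg _) ((norm_nonneg _).trans h3))
  have hsl : ∀ t, Continuous fun x => deriv η t * ψ (x - θ t) := fun t => by fun_prop
  have hI1 : Tendsto (fun ε => ∫ t in (0 : ℝ)..τ,
      ∫ x, ρ t x * (deriv η t * ψ (x - θ t) * cutoff ε x) ∂unitMeasure) (𝓝[>] 0)
      (𝓝 (∫ t in (0 : ℝ)..τ, ∫ x, ρ t x * (deriv η t * ψ (x - θ t)) ∂unitMeasure)) := by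
    refine intervalIntegral.tendsto_integral_filter_of_dominated_convergence
      (fun t => D * ‖ρ t‖) (Eventually.of_forall fun ε => ?_) (Eventually.of_forall fun ε => ?_)
      ((continuous_const.mul hρ.norm).intervalIntegrable _ _) ?_
    · refine (continuous_pairing hρ (g := fun t x => deriv η t * ψ (x - θ t) * cutoff ε x)
        ?_).aestronglyMeasurable
      exact ((hη'.comp continuous_fst).mul hψθ).mul
        ((contDiff_cutoff ε).continuous.comp continuous_snd)
    · refine Eventually.of_forall fun t ht => ?_
      rw [uIoc_of_le hτ.le] at ht
      have hb : ∀ x ∈ Ioo (0 : ℝ) 1, |deriv η t * ψ (x - θ t) * cutoff ε x| ≤ D := fun x hx => by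
        rw [abs_mul]
        exact (mul_le_of_le_one_right (abs_nonneg _) (abs_cutoff_le ε x)).trans
          (hD (t, x) ⟨Ioc_subset_Icc_self ht, Ioo_subset_Icc_self hx⟩)
      have hD0 : 0 ≤ D := (abs_nonneg _).trans (hb (1 / 2) (by norm_num))
      exact (abs_integral_mul_le (integrable_lpUnit _) hb).trans
        (mul_le_mul_of_nonneg_left (integral_abs_le_norm _) hD0)
    · exact Eventually.of_forall fun t _ => tendsto_integral_mul_cutoff (integrable_lpUnit _) (hsl t)
  have hJ := (tendsto_integral_mul_cutoff (integrable_lpUnit ρ₀) hψc).const_mul (η 0)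
  have hsum := (hI1.add hI2).add hJ
  have hid : ∀ᶠ ε in 𝓝[>] (0 : ℝ),
      ((∫ t in (0 : ℝ)..τ, ∫ x, ρ t x * (deriv η t * ψ (x - θ t) * cutoff ε x) ∂unitMeasure)
      + ∫ t in (0 : ℝ)..τ, ∫ x, ρ t x * (a t x * deriv (cutoff ε) x) ∂unitMeasure)
      + η 0 * ∫ x, ρ₀ x * (ψ x * cutoff ε x) ∂unitMeasure
      = -∫ t in (0 : ℝ)..τ, r t * a t 1 := by
    filter_upwards [Ioo_mem_nhdsGT (zero_lt_one : (0 : ℝ) < 1)] with ε hε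
    have hc := contDiff_cutoff ε
    have htest : IsTestFunction τ (fun t x => η t * ψ (x - θ t) * cutoff ε x) := by
      refine ⟨?_, fun x _ => by simp [hητ], fun t _ => by simp [cutoff_one]⟩
      exact ((hη.comp contDiff_fst).mul (hψ.comp (contDiff_snd.sub (hθ.comp contDiff_fst)))).mul
        (hc.comp contDiff_snd)
    have hw := hweak _ htest
    unfold WeakIdentity at hw
    -- The two terms containing ψ' cancel because ψ(x - θ(t)) is constant along characteristics;
    -- only η' and the derivative of the cutoff survive.
    have hinner : ∀ t, ∫ x, ρ t x * (deriv (fun s => η s * ψ (x - θ s) * cutoff ε x) t +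
        lam (mass ρ t) * deriv (fun z => η t * ψ (z - θ t) * cutoff ε z) x) ∂unitMeasure
        = (∫ x, ρ t x * (deriv η t * ψ (x - θ t) * cutoff ε x) ∂unitMeasure)
          + ∫ x, ρ t x * (a t x * deriv (cutoff ε) x) ∂unitMeasure := by
      intro t
      have i1 : Integrable (fun x => ρ t x * (deriv η t * ψ (x - θ t) * cutoff ε x)) unitMeasure :=
        integrable_mul_continuous (integrable_lpUnit _) ((hsl t).mul hc.continuous)
      have i2 : Integrable (fun x => ρ t x * (a t x * deriv (cutoff ε) x)) unitMeasure :=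
        integrable_mul_continuous (integrable_lpUnit _)
          ((ha.comp (by fun_prop : Continuous fun x => (t, x))).mul (hc.continuous_deriv le_rfl))
      rw [← integral_add i1 i2]
      refine integral_congr_ae (Eventually.of_forall fun x => ?_)
      have hψd : ∀ z, HasDerivAt ψ (deriv ψ z) z := fun z =>
        (hψ.differentiable one_ne_zero z).hasDerivAt
      have d1 : HasDerivAt (fun s => η s * ψ (x - θ s) * cutoff ε x)
          ((deriv η t * ψ (x - θ t) + η t * (deriv ψ (x - θ t) * (-lam (mass ρ t))))
            * cutoff ε x) t := by
        refine ((hη.differentiable one_ne_zero t).hasDerivAt.mul ?_).mul_const _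
        exact (hψd (x - θ t)).comp t ((hasDerivAt_travel hlam hρ t).const_sub x)
      have d2 : HasDerivAt (fun z => η t * ψ (z - θ t) * cutoff ε z)
          (η t * (deriv ψ (x - θ t) * 1) * cutoff ε x
            + η t * ψ (x - θ t) * deriv (cutoff ε) x) x := by
        refine HasDerivAt.mul (HasDerivAt.const_mul _ ?_)
          (hc.differentiable one_ne_zero x).hasDerivAt
        exact (hψd (x - θ t)).comp x ((hasDerivAt_id x).sub_const _)
      simp only [d1.deriv, d2.deriv, hadef]
      ring
    -- The cutoff is 0 at x = 1 and 1 at x = 0, so only the influx kyφ(t,0) is left; `hk` rewrites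
    -- it in terms of ψ(1 - θ).
    have hbdry : ∫ t in (0 : ℝ)..τ, (outflux lam ρ r t * (η t * ψ (1 - θ t) * cutoff ε 1)
        - (k * outflux lam ρ r t + (1 - k) * 0 * lam 0) * (η t * ψ (0 - θ t) * cutoff ε 0))
        = -∫ t in (0 : ℝ)..τ, r t * a t 1 := by
      rw [← intervalIntegral.integral_neg]
      refine intervalIntegral.integral_congr fun t ht => ?_
      rw [uIcc_of_le hτ.le] at ht
      simp only [hadef, cutoff_one, cutoff_eq_one hε.1 (by linarith [hε.2] : (0 : ℝ) ≤ 1 - ε),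
        ← hk t ht, outflux, zero_sub]
      ring
    have hinit : ∫ x, ρ₀ x * (η 0 * ψ (x - θ 0) * cutoff ε x) ∂unitMeasure
        = η 0 * ∫ x, ρ₀ x * (ψ x * cutoff ε x) ∂unitMeasure := by
      rw [← integral_const_mul]
      refine integral_congr_ae (Eventually.of_forall fun x => ?_)
      simp only [hθdef, travel_zero, sub_zero]
      ring
    rw [hbdry, hinit] at hw
    simp only [hinner] at hw
    rw [intervalIntegral.integral_add] at hw
    · linarith
    · refine (continuous_pairing hρ (g := fun t x => deriv η t * ψ (x - θ t) * cutoff ε x)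
        ?_).intervalIntegrable _ _
      exact ((hη'.comp continuous_fst).mul hψθ).mul (hc.continuous.comp continuous_snd)
    · exact (continuous_pairing hρ (g := fun t x => a t x * deriv (cutoff ε) x)
        (ha.mul ((hc.continuous_deriv le_rfl).comp continuous_snd))).intervalIntegrable _ _
  -- As ε → 0 the trace term appears on both sides and drops out.
  have hlim := tendsto_nhds_unique (hsum.congr' hid) tendsto_const_nhds
  have hpull : ∀ t, ∫ x, ρ t x * (deriv η t * ψ (x - θ t)) ∂unitMeasure
      = deriv η t * ∫ x, ρ t x * ψ (x - θ t) ∂unitMeasure := by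
    intro t
    rw [← integral_const_mul]
    exact integral_congr_ae (Eventually.of_forall fun x => by ring)
  simp only [hpull] at hlim
  linarith

/-- The pairing of a weak solution with a solution of the adjoint problem is conserved. -/
lemma pairing_eq_initial (hlam : Continuous lam) (hρ : Continuous ρ)
    {k : ℝ} {ρ₀ : LpUnit 2} {r : ℝ → ℝ}
    (hr : IsTraceAtOne ρ r) {τ : ℝ} (hτ : 0 < τ)
    (hweak : ∀ φ : ℝ → ℝ → ℝ, IsTestFunction τ φ →
      WeakIdentity lam 0 k ρ₀ ρ (outflux lam ρ r) τ φ)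
    {ψ : ℝ → ℝ} (hψ : ContDiff ℝ 1 ψ) {K : NNReal} (hK : LipschitzWith K ψ)
    (hk : ∀ t ∈ Icc 0 τ, k * ψ (-travel lam ρ t) = ψ (1 - travel lam ρ t)) :
    ∫ x, ρ τ x * ψ (x - travel lam ρ τ) ∂unitMeasure = ∫ x, ρ₀ x * ψ x ∂unitMeasure := by
  set F₀ := ∫ x, ρ₀ x * ψ x ∂unitMeasure with hF₀
  set F : ℝ → ℝ := fun t => ∫ x, ρ t x * ψ (x - travel lam ρ t) ∂unitMeasure with hF
  have hθc := (contDiff_travel hlam hρ).continuous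
  have hψc := hψ.continuous
  have hFc : Continuous F := continuous_pairing hρ (g := fun t x => ψ (x - travel lam ρ t))
    (by unfold Function.uncurry; fun_prop)
  have hgc : Continuous fun t => F t - F₀ := hFc.sub continuous_const
  -- With η' = F - F₀ and η(τ) = 0, the tested identity becomes the vanishing of the integral of (F
  -- - F₀)², which forces F = F₀ on [0,τ] by continuity.
  set η : ℝ → ℝ := fun t => ∫ s in τ..t, (F s - F₀) with hη
  have hηd : ∀ t, HasDerivAt η (F t - F₀) t := fun t =>
    intervalIntegral.integral_hasDerivAt_right (hgc.intervalIntegrable _ _)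
      (hgc.stronglyMeasurableAtFilter _ _) hgc.continuousAt
  have hη' : deriv η = fun t => F t - F₀ := funext fun t => (hηd t).deriv
  have hηC : ContDiff ℝ 1 η := by
    rw [contDiff_one_iff_deriv]
    exact ⟨fun t => (hηd t).differentiableAt, by rw [hη']; exact hgc⟩
  have hητ : η τ = 0 := by simp [hη]
  have h := integral_deriv_mul_pairing hlam hρ hr hτ hweak hηC hητ hψ hK hk
  have hη0 : η 0 = -∫ t in (0 : ℝ)..τ, (F t - F₀) := intervalIntegral.integral_symm _ _
  rw [hη0, hη'] at h
  have hsq : ∫ t in (0 : ℝ)..τ, (F t - F₀) ^ 2 = 0 := by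
    have e : ∀ t, (F t - F₀) ^ 2 = (F t - F₀) * F t - (F t - F₀) * F₀ := fun t => by ring
    simp only [e]
    have i1 : IntervalIntegrable (fun t => (F t - F₀) * F t) volume 0 τ :=
      (hgc.mul hFc).intervalIntegrable _ _
    have i2 : IntervalIntegrable (fun t => (F t - F₀) * F₀) volume 0 τ :=
      (hgc.mul continuous_const).intervalIntegrable _ _
    rw [intervalIntegral.integral_sub i1 i2, intervalIntegral.integral_mul_const]
    linarith
  by_contra hne
  have hpos : 0 < ∫ t in (0 : ℝ)..τ, (F t - F₀) ^ 2 :=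
    intervalIntegral.integral_pos hτ (hgc.pow 2).continuousOn (fun t _ => sq_nonneg _)
      ⟨τ, ⟨hτ.le, le_rfl⟩, by
        have : F τ - F₀ ≠ 0 := sub_ne_zero.2 hne
        positivity⟩
  exact hpos.ne' hsq

end

/-! ### Plateau functions and the L² norm by duality -/

/-- A smooth function of `x`, vanishing outside `(0,1)` and equal to `1` on `[ε, 1 - ε]`. -/
def plateau (ε x : ℝ) : ℝ := cutoff ε x * cutoff ε (1 - x)

lemma contDiff_plateau (ε : ℝ) : ContDiff ℝ 1 (plateau ε) :=
  (contDiff_cutoff ε).mul ((contDiff_cutoff ε).comp (by fun_prop))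

lemma abs_plateau_le (ε x : ℝ) : |plateau ε x| ≤ 1 := by
  rw [plateau, abs_mul]
  exact mul_le_one₀ (abs_cutoff_le _ _) (abs_nonneg _) (abs_cutoff_le _ _)

lemma cutoff_eq_zero {ε x : ℝ} (hε : 0 < ε) (hx : 1 ≤ x) : cutoff ε x = 0 :=
  Real.smoothTransition.zero_of_nonpos (div_nonpos_of_nonpos_of_nonneg (by linarith) hε.le)

lemma plateau_eq_zero {ε x : ℝ} (hε : 0 < ε) (hx : x ∉ Ioo (0 : ℝ) 1) : plateau ε x = 0 := by
  rcases lt_or_ge 0 x with h | h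
  · rw [plateau, cutoff_eq_zero hε (not_lt.1 fun h1 => hx ⟨h, h1⟩), zero_mul]
  · rw [plateau, cutoff_eq_zero (x := 1 - x) hε (by linarith), mul_zero]

lemma tendsto_integral_mul_plateau {u : ℝ → ℝ} (hu : Integrable u unitMeasure) {g : ℝ → ℝ}
    (hg : Continuous g) :
    Tendsto (fun ε => ∫ x, u x * (g x * plateau ε x) ∂unitMeasure) (𝓝[>] 0)
      (𝓝 (∫ x, u x * g x ∂unitMeasure)) := by
  refine tendsto_integral_filter_of_dominated_convergence (fun x => |u x * g x|)
    (Eventually.of_forall fun ε => ?_) (Eventually.of_forall fun ε => Eventually.of_forall fun x => ?_)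
    (integrable_mul_continuous hu hg).abs ?_
  · exact (integrable_mul_continuous hu
      (hg.mul (contDiff_plateau ε).continuous)).aestronglyMeasurable
  · rw [Real.norm_eq_abs, ← mul_assoc, abs_mul]
    exact mul_le_of_le_one_right (abs_nonneg _) (abs_plateau_le ε x)
  · filter_upwards [ae_mem_unit] with x hx
    refine tendsto_const_nhds.congr' ?_
    filter_upwards [eventually_cutoff_eq_one hx.2,
      eventually_cutoff_eq_one (by linarith [hx.1] : 1 - x < 1)] with ε hε hε'
    rw [plateau, hε, hε', mul_one, mul_one]

lemma memLp_continuous {h : ℝ → ℝ} (hh : Continuous h) : MemLp h 2 unitMeasure := by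
  obtain ⟨G, hG⟩ := (isCompact_Icc (a := (0 : ℝ)) (b := 1)).exists_bound_of_continuousOn
    hh.continuousOn
  refine MemLp.of_bound hh.aestronglyMeasurable G ?_
  filter_upwards [ae_mem_unit] with x hx using hG x (Ioo_subset_Icc_self hx)

lemma inner_eq_integral {u H : LpUnit 2} {h : ℝ → ℝ} (hH : H =ᵐ[unitMeasure] h) :
    inner ℝ H u = ∫ x, u x * h x ∂unitMeasure := by
  rw [L2.inner_def]
  refine integral_congr_ae ?_
  filter_upwards [hH] with x hx
  rw [hx]
  simp

lemma norm_eq_sqrt_integral {H : LpUnit 2} {h : ℝ → ℝ} (hH : H =ᵐ[unitMeasure] h) :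
    ‖H‖ = √(∫ x, h x ^ 2 ∂unitMeasure) := by
  rw [← Real.sqrt_sq (norm_nonneg H), ← real_inner_self_eq_norm_sq, inner_eq_integral hH]
  congr 1
  refine integral_congr_ae ?_
  filter_upwards [hH] with x hx
  rw [hx, sq]

lemma abs_integral_mul_le_norm (u : LpUnit 2) {h : ℝ → ℝ} (hh : Continuous h) :
    |∫ x, u x * h x ∂unitMeasure| ≤ √(∫ x, h x ^ 2 ∂unitMeasure) * ‖u‖ := by
  have hH := (memLp_continuous hh).coeFn_toLp
  rw [← inner_eq_integral hH, ← norm_eq_sqrt_integral hH]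
  exact abs_real_inner_le_norm _ _

/-- Functions of class `C¹` that vanish outside `(0,1)` determine the norm of `L²(0,1)`. -/
lemma norm_le_of_pairing {u : LpUnit 2} {B : ℝ} (hB : 0 ≤ B)
    (h : ∀ f : ℝ → ℝ, ContDiff ℝ 1 f → (∀ x ∉ Ioo (0 : ℝ) 1, f x = 0) →
      |∫ x, u x * f x ∂unitMeasure| ≤ B * √(∫ x, f x ^ 2 ∂unitMeasure)) : ‖u‖ ≤ B := by
  have hsmooth : ∀ g : ℝ → ℝ, ContDiff ℝ 1 g →
      |∫ x, u x * g x ∂unitMeasure| ≤ B * √(∫ x, g x ^ 2 ∂unitMeasure) := by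
    intro g hg
    refine le_of_tendsto (tendsto_integral_mul_plateau (integrable_lpUnit u) hg.continuous).abs ?_
    filter_upwards [self_mem_nhdsWithin] with ε hε
    refine (h (fun x => g x * plateau ε x) (hg.mul (contDiff_plateau ε)) fun x hx => ?_).trans ?_
    · simp only [plateau_eq_zero hε hx, mul_zero]
    · refine mul_le_mul_of_nonneg_left (Real.sqrt_le_sqrt ?_) hB
      refine integral_mono (memLp_continuous (hg.mul (contDiff_plateau ε)).continuous).integrable_sq
        (memLp_continuous hg.continuous).integrable_sq fun x => ?_
      rw [mul_pow]
      exact mul_le_of_le_one_right (sq_nonneg _) (by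
        rw [← sq_abs]; exact pow_le_one₀ (abs_nonneg _) (abs_plateau_le ε x))
  have hclosed : IsClosed {H : LpUnit 2 | |inner ℝ H u| ≤ B * ‖H‖} :=
    isClosed_le (by fun_prop) (by fun_prop)
  -- The bound is a closed condition on H and holds on a dense set of smooth functions; it is then
  -- applied to H = u.
  have hall : ∀ H : LpUnit 2, |inner ℝ H u| ≤ B * ‖H‖ := by
    have hd := (Lp.dense_hasCompactSupport_contDiff (F := ℝ) (μ := unitMeasure)
      (by norm_num : (2 : ℝ≥0∞) ≠ ⊤)).mono (s₂ := {H : LpUnit 2 | |inner ℝ H u| ≤ B * ‖H‖}) (by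
        rintro H ⟨g, hg, -, hgs⟩
        have hg1 : ContDiff ℝ 1 g := hgs.of_le (by exact_mod_cast le_top)
        rw [mem_ofPred_eq, inner_eq_integral hg, norm_eq_sqrt_integral hg]
        exact hsmooth g hg1)
    intro H
    have : H ∈ closure {H : LpUnit 2 | |inner ℝ H u| ≤ B * ‖H‖} := hd H
    rwa [hclosed.closure_eq] at this
  have h1 := hall u
  rw [real_inner_self_eq_norm_sq, abs_of_nonneg (sq_nonneg _)] at h1
  by_contra! hlt
  nlinarith [norm_nonneg u]

/-! ### The explicit adjoint solution -/

/-- The solution of the problem adjoint to transport over a distance `Θ`, with final value `f`, as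
a function on the line of characteristics. The natural number `N` has to be large enough. -/
def adjointProfile (k : ℝ) (f : ℝ → ℝ) (Θ : ℝ) (N : ℕ) (z : ℝ) : ℝ :=
  ∑ n ∈ Finset.range N, k ^ n * f (z + Θ - n)

section

variable {k : ℝ} {f : ℝ → ℝ} {Θ : ℝ} {N : ℕ}

lemma contDiff_adjointProfile (hf : ContDiff ℝ 1 f) : ContDiff ℝ 1 (adjointProfile k f Θ N) := by
  refine ContDiff.sum fun n _ => contDiff_const.mul (hf.comp (by fun_prop))

/-- A finite sum of compactly supported C¹ functions. The Lipschitz constant controls the variation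
of the test function near x = 1 when the trace is taken. -/
lemma lipschitzWith_adjointProfile (hf : ContDiff ℝ 1 f) (hf0 : ∀ x ∉ Ioo (0 : ℝ) 1, f x = 0) :
    ∃ K, LipschitzWith K (adjointProfile k f Θ N) := by
  have hs : HasCompactSupport (adjointProfile k f Θ N) := by
    refine HasCompactSupport.intro (K := Icc (-Θ) (1 + N - Θ)) isCompact_Icc fun z hz => ?_
    refine Finset.sum_eq_zero fun n hn => ?_
    rw [hf0 _ fun h => hz ?_, mul_zero]
    have hnN : (n : ℝ) ≤ N := by exact_mod_cast (Finset.mem_range.1 hn).le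
    have hn0 : (0 : ℝ) ≤ n := n.cast_nonneg
    exact ⟨by linarith [h.1], by linarith [h.2]⟩
  exact (contDiff_adjointProfile hf).lipschitzWith_of_hasCompactSupport hs one_ne_zero

/-- Translation by 1 shifts the summation index. The two unmatched terms vanish: index N because N ≥
Θ + 1 and z ≤ 0, index 0 because z ≥ -Θ. -/
lemma adjointProfile_boundary (hf0 : ∀ x ∉ Ioo (0 : ℝ) 1, f x = 0) (hN : Θ + 1 ≤ N)
    {z : ℝ} (hz : z ∈ Icc (-Θ) 0) :
    k * adjointProfile k f Θ N z = adjointProfile k f Θ N (z + 1) := by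
  have h1 := Finset.sum_range_succ (fun n : ℕ => k ^ n * f (z + 1 + Θ - n)) N
  rw [Finset.sum_range_succ', hf0 (z + 1 + Θ - N) (fun h => by linarith [h.1, hz.2]),
    hf0 (z + 1 + Θ - (0 : ℕ)) (fun h => by
      have := h.2
      push_cast at this
      linarith [hz.1]), mul_zero, mul_zero, add_zero, add_zero] at h1
  rw [adjointProfile, adjointProfile, ← h1, Finset.mul_sum]
  refine Finset.sum_congr rfl fun n _ => ?_
  rw [pow_succ, show z + 1 + Θ - ((n + 1 : ℕ) : ℝ) = z + Θ - n by push_cast; ring]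
  ring

lemma adjointProfile_final (hf0 : ∀ x ∉ Ioo (0 : ℝ) 1, f x = 0) (hN : 0 < N)
    {x : ℝ} (hx : x ∈ Ioo (0 : ℝ) 1) : adjointProfile k f Θ N (x - Θ) = f x := by
  rw [adjointProfile, Finset.sum_eq_single 0]
  · simp
  · intro n _ hn
    have h1 : (1 : ℝ) ≤ n := by exact_mod_cast Nat.one_le_iff_ne_zero.2 hn
    rw [hf0 _ fun h => by linarith [h.1, hx.2], mul_zero]
  · intro h
    exact absurd (Finset.mem_range.2 hN) h

/-- At each point at most one term of the sum does not vanish. -/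
lemma adjointProfile_terms (hf0 : ∀ x ∉ Ioo (0 : ℝ) 1, f x = 0) (z : ℝ) :
    (∀ n ∈ Finset.range N, f (z + Θ - n) = 0) ∨
    ∃ m ∈ Finset.range N, z + Θ - m ∈ Ioo (0 : ℝ) 1 ∧ ∀ n ∈ Finset.range N, n ≠ m →
      f (z + Θ - n) = 0 := by
  by_cases h : ∃ m ∈ Finset.range N, z + Θ - m ∈ Ioo (0 : ℝ) 1
  · obtain ⟨m, hm, hmem⟩ := h
    refine Or.inr ⟨m, hm, hmem, fun n _ hnm => hf0 _ fun hn => hnm ?_⟩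
    have h1 : (n : ℝ) < m + 1 := by linarith [hn.1, hmem.2]
    have h2 : (m : ℝ) < n + 1 := by linarith [hn.2, hmem.1]
    have h1' : n < m + 1 := by exact_mod_cast h1
    have h2' : m < n + 1 := by exact_mod_cast h2
    omega
  · push Not at h
    exact Or.inl fun n hn => hf0 _ (h n hn)

lemma abs_adjointProfile_le (hk : |k| ≤ 1) (hf0 : ∀ x ∉ Ioo (0 : ℝ) 1, f x = 0) {G : ℝ}
    (hG : ∀ x, |f x| ≤ G) (z : ℝ) : |adjointProfile k f Θ N z| ≤ G := by
  rcases adjointProfile_terms (N := N) (Θ := Θ) hf0 z with h | ⟨m, hm, -, h⟩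
  · rw [adjointProfile, Finset.sum_eq_zero fun n hn => by rw [h n hn, mul_zero], abs_zero]
    exact (abs_nonneg _).trans (hG 0)
  · rw [adjointProfile, Finset.sum_eq_single m (fun n hn hnm => by rw [h n hn hnm, mul_zero])
      fun hm' => absurd hm hm', abs_mul, abs_pow]
    exact (mul_le_of_le_one_left (abs_nonneg _) (pow_le_one₀ (abs_nonneg _) hk)).trans (hG _)

/-- The only index m that can contribute satisfies m > z + Θ - 1 ≥ Θ - 1, so its factor |k|ᵐ is at
most exp(-b(Θ - 1)). -/
lemma adjointProfile_sq_le {b : ℝ} (hb : 0 ≤ b) (hk : |k| ≤ Real.exp (-b))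
    (hf0 : ∀ x ∉ Ioo (0 : ℝ) 1, f x = 0) {z : ℝ} (hz : 0 ≤ z) :
    adjointProfile k f Θ N z ^ 2 ≤
      Real.exp (-b * (Θ - 1)) ^ 2 * ∑ n ∈ Finset.range N, f (z + Θ - n) ^ 2 := by
  rcases adjointProfile_terms (N := N) (Θ := Θ) hf0 z with h | ⟨m, hm, hmem, h⟩
  · rw [adjointProfile, Finset.sum_eq_zero fun n hn => by rw [h n hn, mul_zero]]
    simp only [ne_eq, OfNat.ofNat_ne_zero, not_false_eq_true, zero_pow]
    positivity
  · rw [adjointProfile, Finset.sum_eq_single m (fun n hn hnm => by rw [h n hn hnm, mul_zero])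
      fun hm' => absurd hm hm', Finset.sum_eq_single m
      (fun n hn hnm => by rw [h n hn hnm]; simp) fun hm' => absurd hm hm', mul_pow]
    refine mul_le_mul_of_nonneg_right ?_ (sq_nonneg _)
    rw [← sq_abs (k ^ m), abs_pow]
    refine pow_le_pow_left₀ (by positivity) ?_ 2
    calc |k| ^ m ≤ Real.exp (-b) ^ m := pow_le_pow_left₀ (abs_nonneg _) hk m
      _ = Real.exp (m * -b) := (Real.exp_nat_mul _ _).symm
      _ ≤ _ := Real.exp_le_exp.2 (by nlinarith [hmem.2])

/-- The unit intervals seen by the successive translates tile [Θ + 1 - N, Θ + 1], which contains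
(0,1), so the integrals of the squared translates add up to that of f². -/
lemma integral_sq_adjointProfile_le {b : ℝ} (hb : 0 ≤ b) (hk : |k| ≤ Real.exp (-b))
    (hf : ContDiff ℝ 1 f) (hf0 : ∀ x ∉ Ioo (0 : ℝ) 1, f x = 0) (hΘ : 0 ≤ Θ) (hN : Θ + 1 ≤ N) :
    ∫ x, adjointProfile k f Θ N x ^ 2 ∂unitMeasure ≤
      Real.exp (-b * (Θ - 1)) ^ 2 * ∫ x, f x ^ 2 ∂unitMeasure := by
  have hfc := hf.continuous
  have hf2 : Continuous fun x => f x ^ 2 := hfc.pow 2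
  have hint : ∀ a c : ℝ, IntervalIntegrable (fun x => f x ^ 2) volume a c :=
    fun a c => hf2.intervalIntegrable a c
  have hψ := (contDiff_adjointProfile (k := k) (Θ := Θ) (N := N) hf).continuous
  have hsum : ∫ z in (0 : ℝ)..1, ∑ n ∈ Finset.range N, f (z + Θ - n) ^ 2
      = ∫ x in (0 : ℝ)..1, f x ^ 2 := by
    rw [intervalIntegral.integral_finsetSum fun n _ => Continuous.intervalIntegrable (by fun_prop) _ _]
    -- The endpoints decrease with n; the reversed orientation makes the sum telescope.
    have h1 : ∀ n : ℕ, ∫ z in (0 : ℝ)..1, f (z + Θ - n) ^ 2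
        = -∫ x in (Θ + 1 - n)..(Θ + 1 - (n + 1 : ℕ)), f x ^ 2 := by
      intro n
      have := intervalIntegral.integral_comp_add_right (a := 0) (b := 1) (fun x => f x ^ 2) (Θ - n)
      rw [← intervalIntegral.integral_symm]
      simp only [add_sub_assoc]
      rw [this]
      congr 1 <;> push_cast <;> ring
    simp only [h1]
    rw [Finset.sum_neg_distrib, intervalIntegral.sum_integral_adjacent_intervals
      (a := fun n : ℕ => Θ + 1 - (n : ℝ)) fun n _ => hint _ _,
      ← intervalIntegral.integral_symm]
    have hzero : ∀ a c : ℝ, a ≤ c → (∀ x ∈ Icc a c, x ∉ Ioo (0 : ℝ) 1) →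
        ∫ x in a..c, f x ^ 2 = 0 := by
      intro a c hac h
      rw [intervalIntegral.integral_congr (g := fun _ => 0) fun x hx => by
        rw [uIcc_of_le hac] at hx
        simp only [hf0 x (h x hx)]; norm_num]
      simp
    have hl : ∫ x in (Θ + 1 - N)..0, f x ^ 2 = 0 :=
      hzero _ _ (by linarith) fun x hx h => by linarith [h.1, hx.2]
    have hr : ∫ x in (1 : ℝ)..(Θ + 1), f x ^ 2 = 0 :=
      hzero _ _ (by linarith) fun x hx h => by linarith [h.2, hx.1]
    have h2 := intervalIntegral.integral_add_adjacent_intervals (hint (Θ + 1 - N) 0) (hint 0 1)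
    have h3 := intervalIntegral.integral_add_adjacent_intervals (hint (Θ + 1 - N) 1)
      (hint 1 (Θ + 1))
    rw [Nat.cast_zero, sub_zero]
    linarith
  rw [integral_unitMeasure, integral_unitMeasure, ← hsum, ← intervalIntegral.integral_const_mul]
  refine intervalIntegral.integral_mono_on zero_le_one ((hψ.pow 2).intervalIntegrable _ _)
    (Continuous.intervalIntegrable (by fun_prop) _ _) fun z hz => ?_
  exact adjointProfile_sq_le hb hk hf0 hz.1

end

/-! ### A priori bounds on the mass and the L² norm -/

section

variable {lam : ℝ → ℝ} {ρ : ℝ → LpUnit 2} {k : ℝ} {ρ₀ : LpUnit 2} {r : ℝ → ℝ} {τ : ℝ}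

/-- Representation of a weak solution by duality with the adjoint problem. -/
lemma integral_mul_eq_adjointProfile (hlam : Continuous lam) (hpos : ∀ s, 0 < lam s)
    (hρ : Continuous ρ) (hr : IsTraceAtOne ρ r) (hτ : 0 < τ)
    (hweak : ∀ φ : ℝ → ℝ → ℝ, IsTestFunction τ φ →
      WeakIdentity lam 0 k ρ₀ ρ (outflux lam ρ r) τ φ)
    {f : ℝ → ℝ} (hf : ContDiff ℝ 1 f) (hf0 : ∀ x ∉ Ioo (0 : ℝ) 1, f x = 0)
    {N : ℕ} (hN : travel lam ρ τ + 1 ≤ N) :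
    ∫ x, ρ τ x * f x ∂unitMeasure =
      ∫ x, ρ₀ x * adjointProfile k f (travel lam ρ τ) N x ∂unitMeasure := by
  have hmono : Monotone (travel lam ρ) := monotone_of_deriv_nonneg
    (fun t => (hasDerivAt_travel hlam hρ t).differentiableAt) fun t => by
      rw [(hasDerivAt_travel hlam hρ t).deriv]; exact (hpos _).le
  have h0 : 0 ≤ travel lam ρ τ := by
    have := hmono hτ.le
    rwa [travel_zero] at this
  obtain ⟨K, hK⟩ := lipschitzWith_adjointProfile (k := k) (Θ := travel lam ρ τ) (N := N) hf hf0
  rw [← pairing_eq_initial hlam hρ hr hτ hweak (contDiff_adjointProfile hf) hK ?_]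
  · refine integral_congr_ae ?_
    filter_upwards [ae_mem_unit] with x hx
    rw [adjointProfile_final hf0 (by
      have : (0 : ℝ) < N := by linarith
      exact_mod_cast this) hx]
  · intro t ht
    have h1 := hmono ht.1
    rw [travel_zero] at h1
    rw [adjointProfile_boundary hf0 hN ⟨neg_le_neg (hmono ht.2), by linarith⟩]
    congr 1
    ring

/-- The mass is the limit of pairings with plateaus. Their adjoint profiles stay bounded by 1, so
each pairing is at most the L¹ norm of ρ₀. -/
lemma abs_mass_le (hlam : Continuous lam) (hpos : ∀ s, 0 < lam s)
    (hρ : Continuous ρ) (hr : IsTraceAtOne ρ r) (hτ : 0 < τ)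
    (hweak : ∀ φ : ℝ → ℝ → ℝ, IsTestFunction τ φ →
      WeakIdentity lam 0 k ρ₀ ρ (outflux lam ρ r) τ φ) (hk : |k| ≤ 1) :
    |mass ρ τ| ≤ ∫ x, |ρ₀ x| ∂unitMeasure := by
  obtain ⟨N, hN⟩ := exists_nat_ge (travel lam ρ τ + 1)
  have hlim := (tendsto_integral_mul_plateau (integrable_lpUnit (ρ τ)) (g := fun _ => 1)
    continuous_const).abs
  simp only [one_mul, mul_one] at hlim
  refine le_of_tendsto hlim ?_
  filter_upwards [self_mem_nhdsWithin] with ε hε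
  rw [integral_mul_eq_adjointProfile hlam hpos hρ hr hτ hweak (contDiff_plateau ε)
    (fun x hx => plateau_eq_zero hε hx) hN]
  simpa using abs_integral_mul_le (integrable_lpUnit ρ₀) (G := 1) fun x _ =>
    abs_adjointProfile_le (Θ := travel lam ρ τ) (N := N) hk
      (fun x hx => plateau_eq_zero hε hx) (abs_plateau_le ε) x

/-- Duality and Cauchy–Schwarz transfer the L² contraction of the adjoint profile to ρ(τ). The -1 in
the exponent allows for data that have not yet crossed the boundary. -/
lemma norm_le_exp_travel (hlam : Continuous lam) (hpos : ∀ s, 0 < lam s)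
    (hρ : Continuous ρ) (hr : IsTraceAtOne ρ r) (hτ : 0 < τ)
    (hweak : ∀ φ : ℝ → ℝ → ℝ, IsTestFunction τ φ →
      WeakIdentity lam 0 k ρ₀ ρ (outflux lam ρ r) τ φ)
    {b : ℝ} (hb : 0 ≤ b) (hk : |k| ≤ Real.exp (-b)) :
    ‖ρ τ‖ ≤ Real.exp (-b * (travel lam ρ τ - 1)) * ‖ρ₀‖ := by
  obtain ⟨N, hN⟩ := exists_nat_ge (travel lam ρ τ + 1)
  have h0 : 0 ≤ travel lam ρ τ :=
    intervalIntegral.integral_nonneg hτ.le fun t _ => (hpos _).le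
  refine norm_le_of_pairing (by positivity) fun f hf hf0 => ?_
  rw [integral_mul_eq_adjointProfile hlam hpos hρ hr hτ hweak hf hf0 hN]
  refine (abs_integral_mul_le_norm ρ₀ (contDiff_adjointProfile hf).continuous).trans ?_
  have h1 := Real.sqrt_le_sqrt (integral_sq_adjointProfile_le hb hk hf hf0 h0 hN)
  rw [Real.sqrt_mul (sq_nonneg _), Real.sqrt_sq (Real.exp_pos _).le] at h1
  calc _ ≤ Real.exp (-b * (travel lam ρ τ - 1)) * √(∫ x, f x ^ 2 ∂unitMeasure) * ‖ρ₀‖ :=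
        mul_le_mul_of_nonneg_right h1 (norm_nonneg _)
    _ = _ := by ring

end

/-- A weak solution may be frozen at negative times. -/
lemma exists_continuous_extension {lam : ℝ → ℝ} {k : ℝ} {ρ₀ : LpUnit 2} {ρ : ℝ → LpUnit 2}
    (h : IsWeakSolution lam 0 k ρ₀ ρ) :
    ∃ ρ' : ℝ → LpUnit 2, Continuous ρ' ∧ (∀ t, 0 ≤ t → ρ' t = ρ t) ∧
      ∃ r : ℝ → ℝ, IsTraceAtOne ρ' r ∧
        ∀ τ : ℝ, 0 ≤ τ → ∀ φ : ℝ → ℝ → ℝ, IsTestFunction τ φ →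
          WeakIdentity lam 0 k ρ₀ ρ' (outflux lam ρ' r) τ φ := by
  obtain ⟨hc, r, hr, hw⟩ := h
  have he : ∀ t, 0 ≤ t → ρ (max t 0) = ρ t := fun t ht => by rw [max_eq_left ht]
  refine ⟨fun t => ρ (max t 0),
    hc.comp_continuous (by fun_prop) fun t => mem_Ici.2 (le_max_right _ _), he, r, fun T hT => ⟨(hr T hT).1, ?_⟩, fun τ hτ φ hφ => ?_⟩
  · refine (hr T hT).2.congr fun ε => ?_
    congr 1
    refine setIntegral_congr_fun measurableSet_Ioo fun t ht => ?_
    simp only [he t ht.1.le]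
  · have h1 := hw τ hτ φ hφ
    unfold WeakIdentity outflux at h1 ⊢
    refine Eq.trans ?_ h1
    have hm : ∀ t, 0 ≤ t → mass (fun t => ρ (max t 0)) t = mass ρ t := fun t ht => by
      simp only [mass, he t ht]
    congr 1
    · congr 2
      refine intervalIntegral.integral_congr fun t ht => ?_
      rw [uIcc_of_le hτ] at ht
      simp only [hm t ht.1, he t ht.1]
    · refine intervalIntegral.integral_congr fun t ht => ?_
      rw [uIcc_of_le hτ] at ht
      simp only [hm t ht.1]

end NonlocalConservation

end

/-! ### Exponential decay in time -/

open NonlocalConservation in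
theorem theorem4p1 (lam : ℝ → ℝ) (hlam : ContDiff ℝ 1 lam) (hlam_pos : ∀ s : ℝ, 0 < lam s)
    (k : ℝ) (hk : k ∈ Set.Ioo (-1 : ℝ) 1) (R : ℝ) (hR : 0 < R) :
    ∃ C : ℝ, 0 < C ∧ ∃ α : ℝ, 0 < α ∧
      ∀ ρ₀ : NonlocalConservation.LpUnit 2,
        (∫ x, |ρ₀ x| ∂NonlocalConservation.unitMeasure) ≤ R →
        ∀ ρ : ℝ → NonlocalConservation.LpUnit 2,
          NonlocalConservation.IsWeakSolution lam 0 k ρ₀ ρ →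
          ∀ t : ℝ, 0 ≤ t → ‖ρ t‖ ≤ C * Real.exp (-α * t) * ‖ρ₀‖ := by
  obtain ⟨s₀, -, hs₀⟩ := (isCompact_Icc (a := -R) (b := R)).exists_isMinOn
    ⟨0, by constructor <;> linarith⟩ hlam.continuous.continuousOn
  have hk1 : |k| < 1 := abs_lt.2 hk
  -- Replacing |k| by its maximum with 1/2 keeps the logarithm meaningful when k = 0.
  have hq0 : 0 < max |k| (1 / 2) := lt_max_of_lt_right (by norm_num)
  have hq1 : max |k| (1 / 2) < 1 := max_lt hk1 (by norm_num)
  obtain ⟨b, hb⟩ : ∃ b, b = -Real.log (max |k| (1 / 2)) := ⟨_, rfl⟩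
  have hb0 : 0 < b := by rw [hb]; exact neg_pos.2 (Real.log_neg hq0 hq1)
  have hkb : |k| ≤ Real.exp (-b) := by
    rw [hb, neg_neg, Real.exp_log hq0]; exact le_max_left _ _
  refine ⟨Real.exp b, Real.exp_pos b, b * lam s₀, mul_pos hb0 (hlam_pos _), fun ρ₀ hρ₀ ρ hρ => ?_⟩
  obtain ⟨ρ', hc, he, r, hr, hw⟩ := exists_continuous_extension hρ
  have hpos : ∀ t ∈ Ioi (0 : ℝ), ‖ρ' t‖ ≤ Real.exp b * Real.exp (-(b * lam s₀) * t) * ‖ρ₀‖ := by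
    intro t ht
    have ht : 0 < t := ht
    refine (norm_le_exp_travel hlam.continuous hlam_pos hc hr ht (hw t ht.le) hb0.le hkb).trans ?_
    refine mul_le_mul_of_nonneg_right ?_ (norm_nonneg _)
    have htravel : lam s₀ * t ≤ travel lam ρ' t := by
      have h1 : ∫ _ in (0 : ℝ)..t, lam s₀ = lam s₀ * t := by simp [mul_comm]
      rw [← h1]
      -- The mass bound is available at positive times only, so the comparison is made on the open
      -- interval.
      refine intervalIntegral.integral_mono_on_of_le_Ioo ht.le (by simp)
        ((hlam.continuous.comp (continuous_mass hc)).intervalIntegrable _ _) fun s hs => ?_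
      have h2 := abs_mass_le hlam.continuous hlam_pos hc hr hs.1 (hw s hs.1.le) hk1.le
      exact hs₀ (abs_le.1 (h2.trans hρ₀))
    rw [← Real.exp_add]
    refine Real.exp_le_exp.2 ?_
    have := mul_le_mul_of_nonneg_left htravel hb0.le
    linarith
  intro t ht
  rw [← he t ht]
  -- Time 0 is reached from positive times by continuity.
  have hclosed : IsClosed {t | ‖ρ' t‖ ≤ Real.exp b * Real.exp (-(b * lam s₀) * t) * ‖ρ₀‖} :=
    isClosed_le hc.norm (by fun_prop)
  have hsub := hclosed.closure_subset_iff.2 hpos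
  rw [closure_Ioi] at hsub
  exact hsub ht
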